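/- Let $n \ge 3$ be an integer, let $p \equiv 1 \pmod n$ be a prime, let $\xi$ be a primitive $n$-th root of unity, and let $K = \mathbb{Q}(\xi)$ be the $n$-th cyclotomic field. For a field $F$ containing a primitive $n$-th root of unity $\zeta$ and for $a, b \in F^*$, let the symbol algebra $\left(\frac{a,b}{F,\zeta}\right)$ be the associative unital $F$-algebra generated by two elements $x, y$ subject to the relations $x^n = a$, $y^n = b$, $yx = \zeta xy$. An $F$-algebra is called split over $F$ if it is isomorphic, as an $F$-algebra, to a matrix algebra $M_m(F)$ for some $m$. Then $K$ embeds into the field $\mathbb{Q}_p$ of $p$-adic numbers, and there is an integer $\alpha$, not divisible by $p$, that is not an $l$-th power residue modulo $p$ for any divisor $l > 1$ of $n$ (that is, for no such $l$ does $z^l \equiv \alpha \pmod p$ have an integer solution $z$). Moreover, for every such $\alpha$, the symbol algebra $A = \left(\frac{\alpha, p}{K, \xi}\right)$ satisfies: (i) for every embedding $K \hookrightarrow \mathbb{Q}_p$, the $\mathbb{Q}_p$-algebra $A \otimes_K \mathbb{Q}_p$ is not split over $\mathbb{Q}_p$; (ii) $A$ is not split over $K$. -/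

import Mathlib

open scoped TensorProduct

/-- The defining relations `x ^ n = a`, `y ^ n = b`, `y x = ξ x y` of a symbol algebra, imposed on
the free associative `F`-algebra on the two generators `x = ι 0` and `y = ι 1`. -/
inductive SymbolAlgebra.Rel {F : Type*} [Field F] (n : ℕ) (a b ξ : F) :
    FreeAlgebra F (Fin 2) → FreeAlgebra F (Fin 2) → Prop
  | x_pow : SymbolAlgebra.Rel n a b ξ
      (FreeAlgebra.ι F 0 ^ n) (algebraMap F (FreeAlgebra F (Fin 2)) a)
  | y_pow : SymbolAlgebra.Rel n a b ξ
      (FreeAlgebra.ι F 1 ^ n) (algebraMap F (FreeAlgebra F (Fin 2)) b)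
  | y_mul_x : SymbolAlgebra.Rel n a b ξ
      (FreeAlgebra.ι F 1 * FreeAlgebra.ι F 0) (ξ • (FreeAlgebra.ι F 0 * FreeAlgebra.ι F 1))

/-- The symbol algebra `(a, b)_{F, ξ}` of degree `n`: the associative unital `F`-algebra generated
by two elements `x`, `y` subject to `x ^ n = a`, `y ^ n = b`, `y x = ξ x y`. -/
def SymbolAlgebra {F : Type*} [Field F] (n : ℕ) (a b ξ : F) : Type _ :=
  RingQuot (SymbolAlgebra.Rel n a b ξ)

noncomputable instance SymbolAlgebra.instRing {F : Type*} [Field F] (n : ℕ) (a b ξ : F) :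
    Ring (SymbolAlgebra n a b ξ) :=
  inferInstanceAs (Ring (RingQuot (SymbolAlgebra.Rel n a b ξ)))

noncomputable instance SymbolAlgebra.instAlgebra {F : Type*} [Field F] (n : ℕ) (a b ξ : F) :
    Algebra F (SymbolAlgebra n a b ξ) :=
  inferInstanceAs (Algebra F (RingQuot (SymbolAlgebra.Rel n a b ξ)))

/-- An `F`-algebra is split if it is isomorphic, as an `F`-algebra, to a full matrix algebra
`M_m(F)`. The size `m = 0` is only possible for the zero algebra, so that an algebra which is
not split is in particular nonzero. -/
def IsSplitAlgebra (F : Type*) [Field F] (A : Type*) [Ring A] [Algebra F A] : Prop :=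
  ∃ m : ℕ, Nonempty (A ≃ₐ[F] Matrix (Fin m) (Fin m) F)

/-- `α` is an `l`-th power residue modulo `p`. -/
def IsPowerResidue (l p : ℕ) (α : ℤ) : Prop :=
  ∃ x : ℤ, x ^ l ≡ α [ZMOD (p : ℤ)]

open Module Polynomial

/-! The obstruction is ramification. Since `n ∣ p - 1`, the residue hypothesis makes `X ^ n - α`
irreducible modulo `p`. A splitting gives `p`-adic matrices of size `m` with `A ^ n = α`, `B ^ n =
p`, `B A = ξ A B`; here `0 < m ≤ n`, because the symbol algebra is nonzero and spanned by `n ^ 2`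
monomials.

In a suitable basis `A` is integral, and `B = p ^ k B'` with `B'` integral and nonzero modulo `p`.
Modulo `p`, the kernel of `B'` is a proper `A`-stable subspace, of dimension less than `n`;
irreducibility forces it to vanish, so `det B'` is a unit. Determinants in `B ^ n = p` then give `k
n m = m`, so `k n = 1`, impossible for `n > 1`. This is `Padic.symbol_relations_false`; both
non-splitting claims reduce to it. -/

/-! ### Integral matrices and the `p`-adic obstruction -/

/-- An endomorphism of a finite-dimensional vector space over the fraction field of a principal
ideal domain `R` that is integral over `R` has entries in `R` with respect to some basis. -/
theorem LinearMap.exists_basis_toMatrix_eq_map {R K V : Type*} [CommRing R] [IsDomain R]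
    [IsPrincipalIdealRing R] [Field K] [Algebra R K] [IsFractionRing R K] [AddCommGroup V]
    [Module K V] [Module R V] [IsScalarTower R K V] [FiniteDimensional K V] (f : Module.End K V)
    (hf : IsIntegral R f) :
    ∃ (b : Basis (Fin (finrank K V)) K V) (A : Matrix (Fin (finrank K V)) (Fin (finrank K V)) R),
      LinearMap.toMatrix b b f = A.map (algebraMap R K) := by
  classical
  let e := Module.finBasis K V
  let S : Submodule R (Module.End K V) := Subalgebra.toSubmodule (Algebra.adjoin R {f})
  let ev : V → (Module.End K V →ₗ[R] V) := fun v ↦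
    { toFun := fun g ↦ g v, map_add' := fun _ _ ↦ rfl, map_smul' := fun _ _ ↦ rfl }
  -- The sum of the `R[f] eᵢ` is an `f`-stable lattice, finitely generated because `f` is integral,
  -- and hence free over the PID.
  let M : Submodule R V := ⨆ i, S.map (ev (e i))
  have hM : ∀ v ∈ M, f v ∈ M := by
    intro v hv
    refine Submodule.iSup_induction _ (motive := fun v ↦ f v ∈ M) hv ?_ (by simp) ?_
    · rintro i _ ⟨g, hg, rfl⟩
      refine Submodule.mem_iSup_of_mem i ⟨f * g, ?_, rfl⟩
      exact (Algebra.adjoin R {f}).mul_mem (Algebra.self_mem_adjoin_singleton R f) hg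
    · intro x y hx hy
      rw [map_add]
      exact add_mem hx hy
  have : Submodule.IsLattice K M :=
    { fg := Submodule.fg_iSup _ fun i ↦ (hf.fg_adjoin_singleton).map _
      span_eq_top := by
        rw [eq_top_iff, ← e.span_eq, Submodule.span_le]
        rintro _ ⟨i, rfl⟩
        exact Submodule.subset_span
          (Submodule.mem_iSup_of_mem i ⟨1, one_mem (Algebra.adjoin R {f}), rfl⟩) }
  have hfree : Module.Free R M := inferInstance
  have hrank : finrank R M = finrank K V :=
    by
    rw [Module.finrank, Module.finrank, Submodule.IsLattice.rank' K M]
  let b := Module.finBasisOfFinrankEq R M hrank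
  refine ⟨b.extendOfIsLattice K, .of fun i j ↦ b.repr ⟨f (b j), hM _ (b j).2⟩ i, ?_⟩
  ext i j
  rw [LinearMap.toMatrix_apply, Basis.extendOfIsLattice_apply, Matrix.map_apply, Matrix.of_apply]
  have h : f (b j) = ∑ k, algebraMap R K (b.repr ⟨f (b j), hM _ (b j).2⟩ k) •
      b.extendOfIsLattice K k := by
    have := congrArg M.subtype (b.sum_repr ⟨f (b j), hM _ (b j).2⟩)
    rw [map_sum] at this
    simpa [algebraMap_smul] using this.symm
  conv_lhs => rw [h]
  rw [Basis.repr_sum_self]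

/-- Let `A` be a matrix with `A ^ n = c`, of size at most `n`, where `X ^ n - c` is irreducible. A
nonzero matrix that commutes with `A` up to a scalar is invertible. -/
theorem Matrix.det_ne_zero_of_irreducible_X_pow_sub_C {F ι : Type*} [Field F] [Fintype ι]
    [DecidableEq ι] {n : ℕ} {c : F} (hc : Irreducible (X ^ n - C c)) (hι : Fintype.card ι ≤ n)
    {A B : Matrix ι ι F} (hA : A ^ n = algebraMap F _ c) (hB : B ≠ 0) (ξ : F)
    (hBA : B * A = ξ • (A * B)) : B.det ≠ 0 := by
  intro hdet
  let a : Module.End F (ι → F) := Matrix.toLinAlgEquiv' A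
  let b : Module.End F (ι → F) := Matrix.toLinAlgEquiv' B
  have hba : b * a = ξ • (a * b) := by rw [← map_mul, hBA, map_smul, map_mul]
  have ha : a ^ n = algebraMap F _ c := by rw [← map_pow, hA, AlgEquiv.commutes]
  have hW0 : LinearMap.ker b ≠ ⊥ := by
    intro h
    obtain ⟨v, hv0, hv⟩ := Matrix.exists_mulVec_eq_zero_iff.mpr hdet
    have : v ∈ LinearMap.ker b := hv
    rw [h] at this
    exact hv0 this
  have hWlt : finrank F (LinearMap.ker b) < Fintype.card ι := by
    rw [← Module.finrank_fintype_fun_eq_card F (η := ι)]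
    refine Submodule.finrank_lt fun h ↦ hB ?_
    rw [LinearMap.ker_eq_top] at h
    exact (map_eq_zero_iff _ Matrix.toLinAlgEquiv'.injective).mp h
  -- If `b v = 0`, then `b (a v) = ξ a (b v) = 0`.
  have haW : ∀ v ∈ LinearMap.ker b, a v ∈ LinearMap.ker b := by
    intro v hv
    have h := LinearMap.congr_fun hba v
    rwa [LinearMap.smul_apply, Module.End.mul_apply, Module.End.mul_apply, LinearMap.mem_ker.mp hv,
      map_zero, smul_zero] at h
  generalize LinearMap.ker b = W at *
  have hW : Nontrivial W := Submodule.nontrivial_iff_ne_bot.mpr hW0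
  have hpow : (a.restrict haW) ^ n = algebraMap F _ c := by
    rw [Module.End.pow_restrict]
    ext v : 2
    exact LinearMap.congr_fun ha v
  have hdvd : minpoly F (a.restrict haW) ∣ X ^ n - C c := by
    apply minpoly.dvd
    rw [map_sub, map_pow, aeval_X, aeval_C, hpow, sub_self]
  -- On a nonzero stable subspace the minimal polynomial is not a unit, so it is associated to `X ^
  -- n - c`; hence the dimension is at least `n`.
  have hdvd' : X ^ n - C c ∣ minpoly F (a.restrict haW) :=
    (hc.dvd_iff.mp hdvd).elim (fun h ↦ absurd h (minpoly.not_isUnit F _)) fun h ↦ h.dvd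
  have h := Polynomial.natDegree_le_of_dvd
    (hdvd'.trans (LinearMap.minpoly_dvd_charpoly (a.restrict haW)))
    (LinearMap.charpoly_monic _).ne_zero
  rw [LinearMap.charpoly_natDegree, natDegree_X_pow_sub_C] at h
  omega

theorem PadicInt.toZMod_eq_zero_iff {p : ℕ} [Fact p.Prime] {z : ℤ_[p]} :
    PadicInt.toZMod z = 0 ↔ ‖z‖ < 1 := by
  rw [← RingHom.mem_ker, PadicInt.ker_toZMod, IsLocalRing.mem_maximalIdeal, PadicInt.mem_nonunits]

/-- A nonzero `p`-adic matrix is a power of `p` times an integral matrix that is nonzero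
modulo `p`. -/
theorem Padic.exists_matrix_eq_zpow_smul {p : ℕ} [Fact p.Prime] {ι : Type*} [Fintype ι]
    {Y : Matrix ι ι ℚ_[p]} (hY : Y ≠ 0) :
    ∃ (k : ℤ) (Z : Matrix ι ι ℤ_[p]), Y = (p : ℚ_[p]) ^ k • Z.map (algebraMap ℤ_[p] ℚ_[p]) ∧
      Z.map PadicInt.toZMod ≠ 0 := by
  classical
  have hp0 : (p : ℚ_[p]) ≠ 0 := by exact_mod_cast (Fact.out : p.Prime).ne_zero
  obtain ⟨i₀, j₀, h₀⟩ : ∃ i j, Y i j ≠ 0 := by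
    by_contra! h
    exact hY (Matrix.ext h)
  have : Nonempty (ι × ι) := ⟨(i₀, j₀)⟩
  obtain ⟨⟨i, j⟩, hij⟩ := Finite.exists_max fun q : ι × ι ↦ ‖Y q.1 q.2‖
  have hne : Y i j ≠ 0 := fun h ↦ by
    have := hij (i₀, j₀)
    simp only [h, norm_zero] at this
    exact h₀ (norm_le_zero_iff.mp this)
  -- Dividing by `p ^ k` turns the entry of largest norm into a unit.
  set k := (Y i j).valuation with hk
  have hnorm : ‖Y i j‖ = ‖(p : ℚ_[p]) ^ k‖ := by
    rw [Padic.norm_eq_zpow_neg_valuation hne, Padic.norm_p_zpow]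
  have hpk : (p : ℚ_[p]) ^ k ≠ 0 := zpow_ne_zero _ hp0
  have hle : ∀ a b, ‖((p : ℚ_[p]) ^ k)⁻¹ * Y a b‖ ≤ 1 := by
    intro a b
    rw [norm_mul, norm_inv, inv_mul_le_iff₀ (norm_pos_iff.mpr hpk), mul_one, ← hnorm]
    exact hij (a, b)
  refine ⟨k, .of fun a b ↦ ⟨((p : ℚ_[p]) ^ k)⁻¹ * Y a b, hle a b⟩, ?_, fun h ↦ ?_⟩
  · ext a b
    change Y a b = (p : ℚ_[p]) ^ k * (((p : ℚ_[p]) ^ k)⁻¹ * Y a b)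
    rw [mul_inv_cancel_left₀ hpk]
  · have h : ‖((p : ℚ_[p]) ^ k)⁻¹ * Y i j‖ < 1 :=
      PadicInt.toZMod_eq_zero_iff.mp (congrFun (congrFun h i) j)
    have : ‖((p : ℚ_[p]) ^ k)⁻¹ * Y i j‖ = 1 := by
      rw [norm_mul, norm_inv, hnorm, inv_mul_cancel₀ (norm_ne_zero_iff.mpr hpk)]
    exact h.ne this

/-- If `X ^ n - α` is irreducible modulo `p`, the symbol algebra `(α, p)` of degree `n > 1` has no
nonzero `p`-adic representation of dimension at most `n`. -/
theorem Padic.symbol_relations_false {p : ℕ} [Fact p.Prime] {n m : ℕ} (hn : 1 < n) (hm : 0 < m)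
    (hmn : m ≤ n) {α : ℤ} (hα : Irreducible (X ^ n - C (α : ZMod p))) {ξ : ℚ_[p]} (hξ : ξ ^ n = 1)
    {A B : Matrix (Fin m) (Fin m) ℚ_[p]} (hA : A ^ n = algebraMap _ _ (α : ℚ_[p]))
    (hB : B ^ n = algebraMap _ _ (p : ℚ_[p])) (hBA : B * A = ξ • (A * B)) : False := by
  have hp0 : (p : ℚ_[p]) ≠ 0 := by exact_mod_cast (Fact.out : p.Prime).ne_zero
  have hξ1 : ‖ξ‖ ≤ 1 := by
    have : ‖ξ‖ ^ n = 1 := by rw [← norm_pow, hξ, norm_one]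
    exact ((pow_eq_one_iff_of_nonneg (norm_nonneg _) (by omega)).mp this).le
  obtain ⟨ξ', rfl⟩ : ∃ ξ' : ℤ_[p], algebraMap _ _ ξ' = ξ := ⟨⟨ξ, hξ1⟩, rfl⟩
  let V := Fin m → ℚ_[p]
  let f : Module.End ℚ_[p] V := Matrix.toLinAlgEquiv' A
  let g : Module.End ℚ_[p] V := Matrix.toLinAlgEquiv' B
  have hf : f ^ n = algebraMap _ _ (α : ℚ_[p]) := by
    rw [← map_pow, hA, AlgEquiv.commutes]
  have hg : g ^ n = algebraMap _ _ (p : ℚ_[p]) := by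
    rw [← map_pow, hB, AlgEquiv.commutes]
  have hgf : g * f = (algebraMap ℤ_[p] ℚ_[p] ξ') • (f * g) := by
    rw [← map_mul, hBA, map_smul, map_mul]
  have hint : IsIntegral ℤ_[p] f := by
    refine ⟨X ^ n - C (α : ℤ_[p]), monic_X_pow_sub_C _ (by omega), ?_⟩
    rw [eval₂_sub, eval₂_X_pow, eval₂_C, hf, sub_eq_zero]
    simp
  obtain ⟨b, A', hA'⟩ := LinearMap.exists_basis_toMatrix_eq_map (R := ℤ_[p]) f hint
  have hd : finrank ℚ_[p] V = m := by simp [V]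
  let T := LinearMap.toMatrixAlgEquiv b
  have hTf : T f = A'.map (algebraMap ℤ_[p] ℚ_[p]) := hA'
  have hTg : T g ^ n = algebraMap _ _ (p : ℚ_[p]) := by rw [← map_pow, hg, AlgEquiv.commutes]
  have hinj : Function.Injective (algebraMap ℤ_[p] ℚ_[p]) := IsFractionRing.injective _ _
  have hinj' : Function.Injective (fun M : Matrix (Fin (finrank ℚ_[p] V)) (Fin (finrank ℚ_[p] V))
      ℤ_[p] ↦ M.map (algebraMap ℤ_[p] ℚ_[p])) := Matrix.map_injective hinj
  have hne : Nonempty (Fin (finrank ℚ_[p] V)) := ⟨⟨0, by omega⟩⟩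
  have hT0 : T g ≠ 0 := by
    intro h
    rw [h, zero_pow (by omega)] at hTg
    rw [eq_comm, ← (algebraMap ℚ_[p] _).map_zero] at hTg
    exact hp0 (FaithfulSMul.algebraMap_injective _ _ hTg)
  obtain ⟨k, B', hB', hB0⟩ := Padic.exists_matrix_eq_zpow_smul hT0
  have hpk : (p : ℚ_[p]) ^ k ≠ 0 := zpow_ne_zero _ hp0
  have hA'n : A' ^ n = algebraMap _ _ (α : ℤ_[p]) := by
    apply hinj'
    change (algebraMap ℤ_[p] ℚ_[p]).mapMatrix (A' ^ n) = (algebraMap ℤ_[p] ℚ_[p]).mapMatrix _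
    rw [map_pow, RingHom.mapMatrix_apply, ← hTf, ← map_pow, hf, AlgEquiv.commutes]
    simp
  have hBA' : B' * A' = ξ' • (A' * B') := by
    apply hinj'
    change (algebraMap ℤ_[p] ℚ_[p]).mapMatrix (B' * A') =
      (ξ' • (A' * B')).map (algebraMap ℤ_[p] ℚ_[p])
    rw [Matrix.map_smul' _ _ _ (map_mul _), ← RingHom.mapMatrix_apply, map_mul, map_mul]
    simp only [RingHom.mapMatrix_apply]
    -- The relation is linear in `B`, so the factor `p ^ k` cancels.
    have h := congrArg T hgf
    rw [map_mul, map_smul, map_mul, hTf, hB', Matrix.smul_mul, Matrix.mul_smul, smul_comm] at h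
    exact smul_right_injective _ hpk h
  let r := (PadicInt.toZMod (p := p)).mapMatrix (m := Fin (finrank ℚ_[p] V))
  have hdet : (r B').det ≠ 0 := by
    refine Matrix.det_ne_zero_of_irreducible_X_pow_sub_C hα (A := r A') ?_ ?_ hB0
      (PadicInt.toZMod ξ') ?_
    · rwa [Fintype.card_fin, hd]
    · rw [← map_pow, hA'n]
      simp [r]
    · rw [← map_mul, hBA', ← map_mul]
      exact Matrix.map_smul' _ _ _ (map_mul _)
  rw [← RingHom.map_det, Ne, ← RingHom.mem_ker, PadicInt.ker_toZMod,
    IsLocalRing.mem_maximalIdeal, mem_nonunits_iff, not_not, PadicInt.isUnit_iff] at hdet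
  have h := congrArg (fun M ↦ ‖Matrix.det M‖) hTg
  have hdetB : ‖Matrix.det (B'.map (algebraMap ℤ_[p] ℚ_[p]))‖ = 1 := by
    rw [← RingHom.mapMatrix_apply, ← RingHom.map_det]
    exact hdet
  simp only [hB', Matrix.algebraMap_eq_diagonal, Matrix.det_diagonal, Matrix.det_pow,
    Matrix.det_smul, Fintype.card_fin, hd, norm_pow, norm_mul, hdetB, mul_one, Pi.algebraMap_apply,
    Finset.prod_const, Finset.card_univ, Algebra.algebraMap_self, RingHom.id_apply] at h
  rw [Padic.norm_p_zpow, Padic.norm_p, ← zpow_neg_one, ← zpow_natCast, ← zpow_natCast,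
    ← zpow_natCast, ← zpow_mul, ← zpow_mul, ← zpow_mul] at h
  have hp1 : (1 : ℝ) < p := by exact_mod_cast (Fact.out : p.Prime).one_lt
  have h := zpow_right_injective₀ (by linarith) hp1.ne' h
  have hmz : (m : ℤ) ≠ 0 := by omega
  have h' : k * n = 1 := mul_left_cancel₀ hmz (by linarith)
  have := Int.isUnit_iff.mp (IsUnit.of_mul_eq_one k (by linarith : (n : ℤ) * k = 1))
  omega

/-! ### Power residues and irreducibility modulo `p` -/

/-- If `n ∣ p - 1` and `a` is not an `l`-th power in `ZMod p` for any divisor `l > 1` of `n`, then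
the class of `a` has order `n` modulo `n`-th powers. -/
theorem ZMod.dvd_of_pow_eq_one_of_not_pow {p n d : ℕ} [Fact p.Prime] (hn : n ≠ 0)
    (hnp : n ∣ p - 1) {a : ZMod p} (ha0 : a ≠ 0)
    (ha : ∀ l : ℕ, 1 < l → l ∣ n → ¬ ∃ z : ZMod p, z ^ l = a)
    (hd : (a ^ ((p - 1) / n)) ^ d = 1) : n ∣ d := by
  obtain ⟨g, hg⟩ := IsCyclic.exists_generator (α := (ZMod p)ˣ)
  have hord : orderOf g = p - 1 := by
    rw [orderOf_eq_card_of_forall_mem_zpowers hg, Nat.card_eq_fintype_card, ZMod.card_units]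
  obtain ⟨t, ht⟩ : ∃ t : ℕ, g ^ t = Units.mk0 a ha0 :=
    (mem_powers_iff_mem_zpowers.mpr (hg _))
  have ht' : (g : ZMod p) ^ t = a := by
    rw [← Units.val_pow_eq_pow_val, ht, Units.val_mk0]
  obtain ⟨e, he⟩ := hnp
  have he0 : e ≠ 0 := by
    rintro rfl
    have := (Fact.out : p.Prime).two_le
    omega
  rw [he, Nat.mul_div_cancel_left _ (Nat.pos_of_ne_zero hn), ← ht', ← pow_mul, ← pow_mul,
    ← Units.val_pow_eq_pow_val, Units.val_eq_one, ← orderOf_dvd_iff_pow_eq_one, hord, he] at hd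
  have htd : n ∣ t * d := by
    have : e * n ∣ e * (t * d) := by
      rwa [mul_comm e n, show e * (t * d) = t * (e * d) by ring]
    exact Nat.dvd_of_mul_dvd_mul_left (Nat.pos_of_ne_zero he0) this
  -- With `a = g ^ t`, this makes `a` an `n / gcd(n, d)`-th power, so that exponent must be `1`.
  have hlt : n / n.gcd d ∣ t := by
    have hpos : 0 < n.gcd d := Nat.gcd_pos_of_pos_left _ (Nat.pos_of_ne_zero hn)
    refine (Nat.coprime_div_gcd_div_gcd hpos).dvd_of_dvd_mul_right (n := d / n.gcd d) ?_
    rw [← Nat.mul_div_assoc _ (Nat.gcd_dvd_right n d)]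
    exact Nat.div_dvd_div (Nat.gcd_dvd_left n d) htd
  obtain ⟨s, hs⟩ := hlt
  have hl : ¬ 1 < n / n.gcd d := fun h ↦
    ha _ h (Nat.div_dvd_of_dvd (Nat.gcd_dvd_left n d))
      ⟨(g : ZMod p) ^ s, by rw [← pow_mul, mul_comm, ← hs, ht']⟩
  have h1 := Nat.div_mul_cancel (Nat.gcd_dvd_left n d)
  have h2 : n / n.gcd d = 1 := by
    have : n / n.gcd d ≠ 0 := fun h ↦ hn (by rw [← h1, h, zero_mul])
    exact le_antisymm (not_lt.mp hl) (Nat.one_le_iff_ne_zero.mpr this)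
  rw [h2, one_mul] at h1
  exact h1 ▸ Nat.gcd_dvd_right n d

/-- Let `r` be a root of an irreducible factor `q`. With `p = n e + 1`, Frobenius multiplies `r` by
`a ^ e`, and its `deg q`-th iterate fixes `r`. Since `a ^ e` has order `n`, `n ∣ deg q`, so `q` is
the whole polynomial up to a unit. -/
theorem ZMod.irreducible_X_pow_sub_C {p n : ℕ} [Fact p.Prime] (hn : n ≠ 0)
    (hnp : n ∣ p - 1) {a : ZMod p} (ha0 : a ≠ 0)
    (ha : ∀ l : ℕ, 1 < l → l ∣ n → ¬ ∃ z : ZMod p, z ^ l = a) :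
    Irreducible (X ^ n - C a) := by
  obtain ⟨q, hq, hqd⟩ := Polynomial.exists_irreducible_of_natDegree_ne_zero
    (f := X ^ n - C a) (by rwa [natDegree_X_pow_sub_C])
  have : Fact (Irreducible q) := ⟨hq⟩
  let L := AdjoinRoot q
  let pb := AdjoinRoot.powerBasis hq.ne_zero
  have : Module.Finite (ZMod p) L := pb.finite
  have : Finite L := Module.finite_of_finite (ZMod p)
  let _ : Fintype L := Fintype.ofFinite L
  have hcard : Fintype.card L = p ^ q.natDegree := by
    rw [Module.card_eq_pow_finrank (K := ZMod p), ZMod.card, pb.finrank]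
    rfl
  let r : L := AdjoinRoot.root q
  have hr : r ^ n = algebraMap (ZMod p) L a := by
    have h : aeval r (X ^ n - C a) = 0 := by
      rw [AdjoinRoot.aeval_eq, AdjoinRoot.mk_eq_zero]
      exact hqd
    rwa [map_sub, map_pow, aeval_X, aeval_C, sub_eq_zero] at h
  have hr0 : r ≠ 0 := by
    intro h
    rw [h, zero_pow hn, eq_comm, map_eq_zero] at hr
    exact ha0 hr
  obtain ⟨e, he⟩ := hnp
  have hp1 : p = n * e + 1 := by have := (Fact.out : p.Prime).two_le; omega
  have hfrob : ∀ k : ℕ, r ^ p ^ k = r * algebraMap (ZMod p) L ((a ^ e) ^ k) := by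
    intro k
    induction k with
    | zero => simp
    | succ k ih =>
      rw [pow_succ, pow_mul, ih, mul_pow, ← map_pow, ZMod.pow_card]
      have hrp : r ^ p = algebraMap (ZMod p) L (a ^ e) * r := by
        refine (congrArg (r ^ ·) hp1).trans ?_
        rw [pow_succ, pow_mul, hr, ← map_pow]
      rw [hrp, pow_succ (a ^ e) k, map_mul]
      ring
  have h := hfrob q.natDegree
  rw [← hcard, FiniteField.pow_card, eq_comm, mul_eq_left₀ hr0, ← map_one (algebraMap (ZMod p) L)]
    at h
  have h := (algebraMap (ZMod p) L).injective h
  have hdvd : n ∣ q.natDegree := ZMod.dvd_of_pow_eq_one_of_not_pow hn ⟨e, he⟩ ha0 ha (by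
    rwa [he, Nat.mul_div_cancel_left _ (Nat.pos_of_ne_zero hn)])
  have hle := Nat.le_of_dvd hq.natDegree_pos hdvd
  exact (associated_of_dvd_of_natDegree_le hqd (X_pow_sub_C_ne_zero (Nat.pos_of_ne_zero hn) a)
    (by rwa [natDegree_X_pow_sub_C])).irreducible hq

theorem isPowerResidue_iff_exists_zmod {l p : ℕ} {α : ℤ} :
    IsPowerResidue l p α ↔ ∃ z : ZMod p, z ^ l = α := by
  constructor
  · rintro ⟨x, hx⟩
    exact ⟨x, by exact_mod_cast (ZMod.intCast_eq_intCast_iff _ _ _).mpr hx⟩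
  · rintro ⟨z, hz⟩
    obtain ⟨x, rfl⟩ := ZMod.intCast_surjective z
    exact ⟨x, (ZMod.intCast_eq_intCast_iff _ _ _).mp (by exact_mod_cast hz)⟩

/-- A lift of a generator of `(ZMod p)ˣ` works: were it an `l`-th power, its order would divide `(p
- 1) / l`. -/
theorem exists_not_isPowerResidue {p n : ℕ} [Fact p.Prime] (hnp : n ∣ p - 1) :
    ∃ α : ℤ, ¬ (p : ℤ) ∣ α ∧ ∀ l : ℕ, 1 < l → l ∣ n → ¬ IsPowerResidue l p α := by
  obtain ⟨g, hg⟩ := IsCyclic.exists_generator (α := (ZMod p)ˣ)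
  have hord : orderOf g = p - 1 := by
    rw [orderOf_eq_card_of_forall_mem_zpowers hg, Nat.card_eq_fintype_card, ZMod.card_units]
  obtain ⟨α, hα⟩ := ZMod.intCast_surjective (g : ZMod p)
  refine ⟨α, fun h ↦ g.ne_zero ?_, fun l hl hln h ↦ ?_⟩
  · rw [← hα]
    exact (ZMod.intCast_zmod_eq_zero_iff_dvd _ _).mpr h
  · obtain ⟨z, hz⟩ := isPowerResidue_iff_exists_zmod.mp h
    have hz0 : z ≠ 0 := by
      rintro rfl
      rw [zero_pow (by omega), hα] at hz
      exact g.ne_zero hz.symm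
    obtain ⟨e, he⟩ := hln.trans hnp
    have hp := (Fact.out : p.Prime).two_le
    have hge : g ^ e = 1 := by
      ext
      rw [Units.val_pow_eq_pow_val, ← hα, ← hz, ← pow_mul, ← he,
        ZMod.pow_card_sub_one_eq_one hz0, Units.val_one]
    have hdvd := orderOf_dvd_of_pow_eq_one hge
    rw [hord] at hdvd
    have he0 : 0 < e := Nat.pos_of_ne_zero (by rintro rfl; omega)
    have := Nat.le_of_dvd he0 hdvd
    rw [he] at this
    nlinarith

/-! ### Embedding the cyclotomic field into `ℚ_[p]` -/

/-- Hensel's lemma lifts a primitive `n`-th root of unity from `ZMod p`; the lift stays primitive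
because its reduction is. -/
theorem Padic.exists_isPrimitiveRoot {p n : ℕ} [Fact p.Prime] (hnp : n ∣ p - 1) :
    ∃ ζ : ℚ_[p], IsPrimitiveRoot ζ n := by
  obtain ⟨g, hg⟩ := IsCyclic.exists_generator (α := (ZMod p)ˣ)
  have hord : orderOf g = p - 1 := by
    rw [orderOf_eq_card_of_forall_mem_zpowers hg, Nat.card_eq_fintype_card, ZMod.card_units]
  have hp := (Fact.out : p.Prime).two_le
  obtain ⟨e, he⟩ := hnp
  have hprim : IsPrimitiveRoot ((g : ZMod p) ^ e) n := by
    refine IsPrimitiveRoot.pow (n := p - 1) (by omega) ?_ (by rw [he, mul_comm])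
    rw [← hord, IsPrimitiveRoot.coe_units_iff]
    exact IsPrimitiveRoot.orderOf g
  obtain ⟨a, ha⟩ := ZMod.ringHom_surjective (PadicInt.toZMod (p := p)) ((g : ZMod p) ^ e)
  -- The derivative `n a ^ (n - 1)` is a unit, since `n ≤ p - 1` and `a` is nonzero modulo `p`.
  have hder : ‖aeval a (derivative (X ^ n - 1 : ℤ_[p][X]))‖ = 1 := by
    refine le_antisymm (PadicInt.norm_le_one _) (not_lt.mp fun h ↦ ?_)
    rw [← PadicInt.toZMod_eq_zero_iff] at h
    simp only [derivative_sub, derivative_X_pow, derivative_one, sub_zero, map_mul, map_pow,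
      aeval_X, map_natCast, ha, mul_eq_zero] at h
    rcases h with h | h
    · rw [ZMod.natCast_eq_zero_iff] at h
      have h1 := Nat.le_of_dvd (by omega) (h.trans ⟨e, he⟩)
      omega
    · exact pow_ne_zero _ (pow_ne_zero _ g.ne_zero) h
  have hval : ‖aeval a (X ^ n - 1 : ℤ_[p][X])‖ < 1 := by
    rw [← PadicInt.toZMod_eq_zero_iff, map_sub, map_pow, aeval_X, map_one, map_sub, map_pow, ha, hprim.pow_eq_one,
      map_one, sub_self]
  obtain ⟨z, hz, hza, -⟩ := hensels_lemma (F := (X ^ n - 1 : ℤ_[p][X])) (a := a)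
    (by rwa [hder, one_pow])
  rw [hder, ← PadicInt.toZMod_eq_zero_iff, map_sub, ha, sub_eq_zero] at hza
  rw [map_sub, map_pow, aeval_X, map_one, sub_eq_zero] at hz
  have hzprim : IsPrimitiveRoot z n := by
    refine ⟨hz, fun l hl ↦ hprim.dvd_of_pow_eq_one l ?_⟩
    rw [← hza, ← map_pow, hl, map_one]
  exact ⟨_, hzprim.map_of_injective (f := algebraMap ℤ_[p] ℚ_[p]) (IsFractionRing.injective _ _)⟩

theorem IsCyclotomicExtension.nonempty_ringHom_padic {p n : ℕ} [Fact p.Prime] [NeZero n]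
    (hnp : n ∣ p - 1) (K : Type*) [Field K] [Algebra ℚ K] [IsCyclotomicExtension {n} ℚ K] :
    Nonempty (K →+* ℚ_[p]) := by
  obtain ⟨ζ, hζ⟩ := Padic.exists_isPrimitiveRoot (p := p) hnp
  have hK := IsCyclotomicExtension.zeta_spec n ℚ K
  exact ⟨((hK.embeddingsEquivPrimitiveRoots ℚ_[p]
    (cyclotomic.irreducible_rat (NeZero.pos n))).symm
      ⟨ζ, (mem_primitiveRoots (NeZero.pos n)).mpr hζ⟩).toRingHom⟩

/-! ### Dimension bounds for symbol algebras -/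

/-- An algebra generated by `x` and `y` with `x ^ n` and `y ^ n` scalar and `y x = ξ x y` is spanned
by the `n ^ 2` monomials `x ^ i y ^ j` with `i, j < n`. -/
theorem Algebra.span_range_pow_mul_pow_eq_top {F A : Type*} [Field F] [Ring A] [Algebra F A] {n : ℕ}
    (hn : n ≠ 0) {a b ξ : F} {x y : A} (hx : x ^ n = algebraMap F A a)
    (hy : y ^ n = algebraMap F A b) (hyx : y * x = ξ • (x * y))
    (hxy : Algebra.adjoin F {x, y} = ⊤) :
    Submodule.span F (Set.range fun q : Fin n × Fin n ↦ x ^ (q.1 : ℕ) * y ^ (q.2 : ℕ)) = ⊤ := by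
  have hnpos := Nat.pos_of_ne_zero hn
  set S := Submodule.span F (Set.range fun q : Fin n × Fin n ↦ x ^ (q.1 : ℕ) * y ^ (q.2 : ℕ))
  have hred : ∀ {z : A} {c : F} (_ : z ^ n = algebraMap F A c) (i : ℕ),
      z ^ i = c ^ (i / n) • z ^ (i % n) := fun {z c} hz i ↦ by
    conv_lhs => rw [← Nat.div_add_mod i n, pow_add, pow_mul, hz, ← map_pow, ← Algebra.smul_def]
  have hS : ∀ i j : ℕ, x ^ i * y ^ j ∈ S := fun i j ↦ by
    rw [hred hx i, hred hy j, smul_mul_smul_comm]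
    exact S.smul_mem _ (Submodule.subset_span
      ⟨(⟨i % n, Nat.mod_lt _ hnpos⟩, ⟨j % n, Nat.mod_lt _ hnpos⟩), rfl⟩)
  have hyx' : ∀ j : ℕ, y ^ j * x = ξ ^ j • (x * y ^ j) := fun j ↦ by
    induction j with
    | zero => simp
    | succ j ih =>
      rw [pow_succ, mul_assoc, hyx, mul_smul_comm, ← mul_assoc, ih, smul_mul_assoc, smul_smul,
        mul_assoc, pow_succ' ξ]
  have hyx'' : ∀ i j : ℕ, y ^ j * x ^ i = (ξ ^ j) ^ i • (x ^ i * y ^ j) := fun i j ↦ by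
    induction i with
    | zero => simp
    | succ i ih =>
      rw [pow_succ x, ← mul_assoc, ih, smul_mul_assoc, mul_assoc, hyx', mul_smul_comm, smul_smul,
        ← mul_assoc, pow_succ (ξ ^ j)]
  have hcl : ∀ z ∈ Submonoid.closure {x, y}, ∃ (c : F) (i j : ℕ), z = c • (x ^ i * y ^ j) := by
    intro z hz
    induction hz using Submonoid.closure_induction with
    | mem z hz =>
      rcases hz with rfl | rfl
      · exact ⟨1, 1, 0, by simp⟩
      · exact ⟨1, 0, 1, by simp⟩
    | one => exact ⟨1, 0, 0, by simp⟩
    | mul z w _ _ hz hw =>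
      obtain ⟨c, i, j, rfl⟩ := hz
      obtain ⟨d, k, l, rfl⟩ := hw
      refine ⟨c * d * (ξ ^ j) ^ k, i + k, j + l, ?_⟩
      rw [smul_mul_smul_comm, mul_assoc, ← mul_assoc (y ^ j), hyx'', smul_mul_assoc, mul_smul_comm,
        smul_smul, pow_add, pow_add]
      simp only [mul_assoc]
  refine top_le_iff.mp ?_
  rw [← Algebra.top_toSubmodule (R := F) (A := A), ← hxy, Algebra.adjoin_eq_span, Submodule.span_le]
  intro z hz
  obtain ⟨c, i, j, rfl⟩ := hcl z hz
  exact S.smul_mem _ (hS i j)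

namespace SymbolAlgebra

variable {F : Type*} [Field F] {n : ℕ} {a b ξ : F}

/-- The quotient map from the free algebra onto the symbol algebra. -/
noncomputable def mk (n : ℕ) (a b ξ : F) : FreeAlgebra F (Fin 2) →ₐ[F] SymbolAlgebra n a b ξ :=
  RingQuot.mkAlgHom F (Rel n a b ξ)

theorem mk_surjective : Function.Surjective (mk n a b ξ) :=
  RingQuot.mkAlgHom_surjective F (Rel n a b ξ)

theorem mk_eq_mk {u v : FreeAlgebra F (Fin 2)} (h : Rel n a b ξ u v) :
    mk n a b ξ u = mk n a b ξ v :=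
  RingQuot.mkAlgHom_rel F h

/-- The first generator of the symbol algebra. -/
noncomputable def x (n : ℕ) (a b ξ : F) : SymbolAlgebra n a b ξ := mk n a b ξ (FreeAlgebra.ι F 0)

/-- The second generator of the symbol algebra. -/
noncomputable def y (n : ℕ) (a b ξ : F) : SymbolAlgebra n a b ξ := mk n a b ξ (FreeAlgebra.ι F 1)

theorem x_pow : x n a b ξ ^ n = algebraMap F _ a := by
  rw [x, ← map_pow, mk_eq_mk Rel.x_pow, AlgHom.commutes]

theorem y_pow : y n a b ξ ^ n = algebraMap F _ b := by
  rw [y, ← map_pow, mk_eq_mk Rel.y_pow, AlgHom.commutes]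

theorem y_mul_x : y n a b ξ * x n a b ξ = ξ • (x n a b ξ * y n a b ξ) := by
  rw [x, y, ← map_mul, mk_eq_mk Rel.y_mul_x, map_smul, map_mul]

theorem adjoin_eq_top : Algebra.adjoin F {x n a b ξ, y n a b ξ} = ⊤ := by
  have h : ({x n a b ξ, y n a b ξ} : Set (SymbolAlgebra n a b ξ)) =
      mk n a b ξ '' Set.range (FreeAlgebra.ι F) := by
    rw [← Set.range_comp, Fin.range_fin_succ, Set.range_unique]
    rfl
  rw [h, ← AlgHom.map_adjoin, FreeAlgebra.adjoin_range_ι, Algebra.map_top,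
    AlgHom.range_eq_top]
  exact mk_surjective

theorem span_eq_top (hn : n ≠ 0) : Submodule.span F (Set.range fun q : Fin n × Fin n ↦
    x n a b ξ ^ (q.1 : ℕ) * y n a b ξ ^ (q.2 : ℕ)) = ⊤ :=
  Algebra.span_range_pow_mul_pow_eq_top hn x_pow y_pow y_mul_x adjoin_eq_top

theorem finite (hn : n ≠ 0) : Module.Finite F (SymbolAlgebra n a b ξ) :=
  Module.finite_def.mpr (span_eq_top (a := a) (b := b) (ξ := ξ) hn ▸
    Submodule.fg_span (Set.finite_range _))

theorem finrank_le (hn : n ≠ 0) : finrank F (SymbolAlgebra n a b ξ) ≤ n ^ 2 := by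
  rw [← finrank_top F (SymbolAlgebra n a b ξ), ← span_eq_top (a := a) (b := b) (ξ := ξ) hn]
  exact (finrank_range_le_card _).trans (by simp [sq])

/-- A symbol algebra is nonzero: over an algebraic closure, it acts on the functions on `ZMod n` by
a diagonal operator and a cyclic shift. -/
theorem nontrivial (hn : n ≠ 0) (hξ : IsPrimitiveRoot ξ n) :
    Nontrivial (SymbolAlgebra n a b ξ) := by
  have : NeZero n := ⟨hn⟩
  let E := AlgebraicClosure F
  obtain ⟨a', ha'⟩ := IsAlgClosed.exists_pow_nat_eq (algebraMap F E a) (Nat.pos_of_ne_zero hn)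
  obtain ⟨b', hb'⟩ := IsAlgClosed.exists_pow_nat_eq (algebraMap F E b) (Nat.pos_of_ne_zero hn)
  let ζ : E := algebraMap F E ξ
  have hζ : ζ ^ n = 1 := by rw [← map_pow, hξ.pow_eq_one, map_one]
  -- The wrap-around at `i = n - 1` is absorbed by `ζ ^ n = 1`.
  have hζs : ∀ i : ZMod n, ζ ^ (i + 1).val = ζ * ζ ^ i.val := fun i ↦ by
    rw [← pow_succ', ZMod.val_add, ZMod.val_one_eq_one_mod, Nat.add_mod_mod, ← pow_eq_pow_mod _ hζ]
  let X : Module.End E (ZMod n → E) :=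
    { toFun := fun v i ↦ a' * ζ ^ i.val * v i
      map_add' := fun v w ↦ by ext i; simp [mul_add]
      map_smul' := fun c v ↦ by ext i; simp; ring }
  let Y : Module.End E (ZMod n → E) :=
    { toFun := fun v i ↦ b' * v (i + 1)
      map_add' := fun v w ↦ by ext i; simp [mul_add]
      map_smul' := fun c v ↦ by ext i; simp; ring }
  have hX : ∀ (k : ℕ) v i, (X ^ k) v i = (a' * ζ ^ i.val) ^ k * v i := fun k ↦ by
    induction k with
    | zero => simp
    | succ k ih =>
      intro v i
      rw [pow_succ, Module.End.mul_apply, ih, pow_succ, mul_assoc]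
      rfl
  have hY : ∀ (k : ℕ) v i, (Y ^ k) v i = b' ^ k * v (i + k) := fun k ↦ by
    induction k with
    | zero => simp
    | succ k ih =>
      intro v i
      rw [pow_succ, Module.End.mul_apply, ih, pow_succ, mul_assoc, Nat.cast_succ, ← add_assoc]
      rfl
  let φ : FreeAlgebra F (Fin 2) →ₐ[F] Module.End E (ZMod n → E) := FreeAlgebra.lift F ![X, Y]
  have hφ0 : φ (FreeAlgebra.ι F 0) = X := FreeAlgebra.lift_ι_apply _ _
  have hφ1 : φ (FreeAlgebra.ι F 1) = Y := FreeAlgebra.lift_ι_apply _ _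
  have halg : ∀ (c : F) v i, (algebraMap F (Module.End E (ZMod n → E)) c) v i =
      algebraMap F E c * v i := fun c v i ↦ by
    rw [Module.algebraMap_end_apply, Pi.smul_apply, Algebra.smul_def]
  have hφ : ∀ ⦃u v⦄, Rel n a b ξ u v → φ u = φ v := by
    rintro _ _ (_ | _ | _)
    · rw [map_pow, hφ0, AlgHom.commutes]
      refine LinearMap.ext fun v ↦ funext fun i ↦ ?_
      rw [hX, halg, mul_pow, ha', pow_right_comm, hζ, one_pow, mul_one]
    · rw [map_pow, hφ1, AlgHom.commutes]
      refine LinearMap.ext fun v ↦ funext fun i ↦ ?_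
      rw [hY, halg, hb', ZMod.natCast_self, add_zero]
    · rw [map_mul, map_smul, map_mul, hφ0, hφ1]
      refine LinearMap.ext fun v ↦ funext fun i ↦ ?_
      rw [LinearMap.smul_apply, Pi.smul_apply, Algebra.smul_def]
      change b' * (a' * ζ ^ (i + 1).val * v (i + 1)) = ζ * (a' * ζ ^ i.val * (b' * v (i + 1)))
      rw [hζs]
      ring
  let ψ : SymbolAlgebra n a b ξ →ₐ[F] Module.End E (ZMod n → E) :=
    RingQuot.liftAlgHom F ⟨φ, hφ⟩
  exact ψ.toRingHom.domain_nontrivial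

theorem finrank_pos (hn : n ≠ 0) (hξ : IsPrimitiveRoot ξ n) :
    0 < finrank F (SymbolAlgebra n a b ξ) := by
  have := finite (a := a) (b := b) (ξ := ξ) hn
  have := nontrivial (a := a) (b := b) hn hξ
  exact Module.finrank_pos

/-- These bounds suffice for the obstruction, so the exact dimension `n ^ 2` is never needed. -/
theorem size_bounds_of_sq_eq_finrank (hn : n ≠ 0) (hξ : IsPrimitiveRoot ξ n) {m : ℕ}
    (hm : finrank F (SymbolAlgebra n a b ξ) = m ^ 2) : 0 < m ∧ m ≤ n := by
  have h1 := finrank_pos (a := a) (b := b) hn hξ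
  have h2 := finrank_le (a := a) (b := b) (ξ := ξ) hn
  rw [hm] at h1 h2
  exact ⟨pos_of_ne_zero (by rintro rfl; simp at h1), (Nat.pow_le_pow_iff_left two_ne_zero).mp h2⟩

end SymbolAlgebra

/-! ### Non-splitting over `ℚ_[p]` and over `K` -/

section

variable {n p : ℕ} [Fact p.Prime] {K : Type*} [Field K] {ξ : K} {α : ℤ}

/-- If `X ^ n - α` is irreducible modulo `p`, the symbol algebra `(α, p)` of degree `n > 1` does not
split over `ℚ_[p]`. -/
theorem SymbolAlgebra.not_isSplitAlgebra_baseChange_padic (hn : 1 < n) (hξ : IsPrimitiveRoot ξ n)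
    (hα : Irreducible (X ^ n - C (α : ZMod p))) [Algebra K ℚ_[p]] :
    ¬ IsSplitAlgebra ℚ_[p] (ℚ_[p] ⊗[K] SymbolAlgebra n (α : K) (p : K) ξ) := by
  rintro ⟨m, ⟨e⟩⟩
  let ι : SymbolAlgebra n (α : K) (p : K) ξ →ₐ[K] ℚ_[p] ⊗[K] SymbolAlgebra n (α : K) (p : K) ξ :=
    Algebra.TensorProduct.includeRight
  have hι : ∀ c : K, ι (algebraMap K _ c) = algebraMap ℚ_[p] _ (algebraMap K ℚ_[p] c) := fun c ↦ by
    rw [AlgHom.commutes, IsScalarTower.algebraMap_apply K ℚ_[p]]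
  have hm := e.toLinearEquiv.finrank_eq
  rw [Module.finrank_baseChange, Module.finrank_matrix, Fintype.card_fin, finrank_self, mul_one,
    ← sq] at hm
  obtain ⟨hm0, hmn⟩ := size_bounds_of_sq_eq_finrank (by omega) hξ hm
  refine Padic.symbol_relations_false hn hm0 hmn hα (ξ := algebraMap K ℚ_[p] ξ)
    (A := e (ι (x n _ _ ξ))) (B := e (ι (y n _ _ ξ))) ?_ ?_ ?_ ?_
  · rw [← map_pow, hξ.pow_eq_one, map_one]
  · rw [← map_pow, ← map_pow, x_pow, hι, AlgEquiv.commutes, map_intCast]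
  · rw [← map_pow, ← map_pow, y_pow, hι, AlgEquiv.commutes, map_natCast]
  · rw [← map_mul, ← map_mul, y_mul_x, map_smul, ← algebraMap_smul ℚ_[p], map_smul, map_mul,
      map_mul]

/-- If `X ^ n - α` is irreducible modulo `p` and `K` embeds into `ℚ_[p]`, the symbol algebra
`(α, p)` of degree `n > 1` does not split over `K`. -/
theorem SymbolAlgebra.not_isSplitAlgebra_of_padic (hn : 1 < n) (hξ : IsPrimitiveRoot ξ n)
    (hα : Irreducible (X ^ n - C (α : ZMod p))) (σ : K →+* ℚ_[p]) :
    ¬ IsSplitAlgebra K (SymbolAlgebra n (α : K) (p : K) ξ) := by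
  rintro ⟨m, ⟨e⟩⟩
  have hm := e.toLinearEquiv.finrank_eq
  rw [Module.finrank_matrix, Fintype.card_fin, finrank_self, mul_one, ← sq] at hm
  obtain ⟨hm0, hmn⟩ := size_bounds_of_sq_eq_finrank (by omega) hξ hm
  have hσ : ∀ c : K, σ.mapMatrix (m := Fin m) (algebraMap K _ c) = algebraMap ℚ_[p] _ (σ c) :=
    fun c ↦ by
      rw [Matrix.algebraMap_eq_diagonal, Matrix.algebraMap_eq_diagonal, RingHom.mapMatrix_apply,
        Matrix.diagonal_map (map_zero σ)]
      rfl
  -- Applying `σ` entrywise gives `p`-adic matrices directly, with no tensor product.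
  refine Padic.symbol_relations_false hn hm0 hmn hα (ξ := σ ξ)
    (A := σ.mapMatrix (e (x n _ _ ξ))) (B := σ.mapMatrix (e (y n _ _ ξ))) ?_ ?_ ?_ ?_
  · rw [← map_pow, hξ.pow_eq_one, map_one]
  · rw [← map_pow, ← map_pow, x_pow, AlgEquiv.commutes, hσ, map_intCast]
  · rw [← map_pow, ← map_pow, y_pow, AlgEquiv.commutes, hσ, map_natCast]
  · rw [← map_mul, ← map_mul, y_mul_x, map_smul, ← map_mul σ.mapMatrix, ← map_mul e]
    exact Matrix.map_smul' _ _ _ (map_mul σ)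

end

theorem theorem4p1 (n : ℕ) (hn : 3 ≤ n) (p : ℕ) [Fact p.Prime] (hp : p ≡ 1 [MOD n])
    (K : Type*) [Field K] [Algebra ℚ K] [IsCyclotomicExtension {n} ℚ K]
    (ξ : K) (hξ : IsPrimitiveRoot ξ n) :
    Nonempty (K →+* ℚ_[p]) ∧
    (∃ α : ℤ, ¬ (p : ℤ) ∣ α ∧ ∀ l : ℕ, 1 < l → l ∣ n → ¬ IsPowerResidue l p α) ∧
    ∀ α : ℤ, ¬ (p : ℤ) ∣ α → (∀ l : ℕ, 1 < l → l ∣ n → ¬ IsPowerResidue l p α) →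
      (∀ [Algebra K ℚ_[p]],
        ¬ IsSplitAlgebra ℚ_[p] (ℚ_[p] ⊗[K] SymbolAlgebra n (α : K) (p : K) ξ)) ∧
      ¬ IsSplitAlgebra K (SymbolAlgebra n (α : K) (p : K) ξ) := by
  have hn0 : n ≠ 0 := by omega
  have : NeZero n := ⟨hn0⟩
  have hnp : n ∣ p - 1 := (Nat.modEq_iff_dvd' (Fact.out : p.Prime).one_le).mp hp.symm
  obtain ⟨σ⟩ := IsCyclotomicExtension.nonempty_ringHom_padic (p := p) hnp K
  refine ⟨⟨σ⟩, exists_not_isPowerResidue hnp, fun α hpα hα ↦ ?_⟩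
  have hirr : Irreducible (X ^ n - C (α : ZMod p)) :=
    ZMod.irreducible_X_pow_sub_C hn0 hnp
      (fun h ↦ hpα ((ZMod.intCast_zmod_eq_zero_iff_dvd _ _).mp h))
      fun l hl hln h ↦ hα l hl hln (isPowerResidue_iff_exists_zmod.mpr h)
  exact ⟨SymbolAlgebra.not_isSplitAlgebra_baseChange_padic (by omega) hξ hirr,
    SymbolAlgebra.not_isSplitAlgebra_of_padic (by omega) hξ hirr σ⟩
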